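/- Let $A, B$ be positive definite complex $n\times n$ matrices, let $X$ be any complex $n\times n$ matrix, and let $|||\cdot|||$ be a unitarily invariant norm on the complex $n\times n$ matrices, i.e. a norm with $|||UYV|||=|||Y|||$ for every matrix $Y$ and all unitary matrices $U,V$. Then for every $\nu\in[0,1]$, $$|||A^{\nu}XB^{1-\nu}+A^{1-\nu}XB^{\nu}|||\le |||4r_1(\nu)A^{1/2}XB^{1/2}+(1-2r_1(\nu))(AX+XB)|||,$$ where $r_1(\nu)=\min\{\nu,\ |\tfrac12-\nu|,\ 1-\nu\}$. -/

import Mathlib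

open scoped MatrixOrder ComplexOrder

/-- A unitarily invariant norm on the complex `n × n` matrices: a seminorm `N` which is definite
(hence a norm) and satisfies `N (U * X * V) = N X` for all unitary `U`, `V`. -/
structure IsUnitarilyInvariantNorm {n : ℕ} (N : Seminorm ℂ (Matrix (Fin n) (Fin n) ℂ)) : Prop where
  eq_zero_of_map_eq_zero : ∀ X : Matrix (Fin n) (Fin n) ℂ, N X = 0 → X = 0
  map_unitary_mul_mul : ∀ U ∈ Matrix.unitaryGroup (Fin n) ℂ, ∀ V ∈ Matrix.unitaryGroup (Fin n) ℂ,
    ∀ X : Matrix (Fin n) (Fin n) ℂ, N (U * X * V) = N X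

/-- The coefficient `r₁(ν) = min {ν, |1/2 - ν|, 1 - ν}`. -/
noncomputable def rOne (ν : ℝ) : ℝ := min ν (min |1 / 2 - ν| (1 - ν))

/-! Diagonalise `A` and `B`. In the eigenbases both sides are entrywise multiples of `star U * X *
V`, and unitary invariance removes the outer unitaries. With `x = log a / 2`, `y = log b / 2`, `t =
x - y`, `β = |1 - 2ν|` and `cos θ = 2r / (1 - 2r)`, the left side is the right side multiplied
entrywise by `cosh (β t) (1 + cos θ) / (cosh t + cos θ)` (`heinz_scalar_identity`). It remains to
show that this multiplier does not increase `N`. Euler products turn it into a limit of products of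
factors `(1 + p t²) / (1 + q t²)`. Each factor with `0 ≤ p ≤ q` is a contraction (`one_add_sq_div`),
and contractions are closed under products, convex combinations and pointwise limits. The needed
inequalities between zeros reduce to `(π - θ) β ≤ π / 2`, which `exists_cos_eq_of_rOne` supplies. -/

/-! ### Euler product of the cosine -/

open Filter Topology in
/-- The Euler product of the cosine, away from the zeros of `sin (π z)`. -/
theorem tendsto_euler_cos_prod {z : ℂ} (hz : z = 0 ∨ Complex.sin (Real.pi * z) ≠ 0) :
    Tendsto (fun n : ℕ => ∏ k ∈ Finset.range n, (1 - 4 * z ^ 2 / (2 * (k : ℂ) + 1) ^ 2)) atTop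
      (𝓝 (Complex.cos (Real.pi * z))) := by
  rcases hz with rfl | hz
  · simp
  have hz0 : (Real.pi : ℂ) * z ≠ 0 := fun h => hz (by rw [h, Complex.sin_zero])
  set S : ℂ → ℕ → ℂ := fun w n =>
    Real.pi * w * ∏ j ∈ Finset.range n, ((1 : ℂ) - w ^ 2 / ((j : ℂ) + 1) ^ 2) with hS
  have h1 : Tendsto (S z) atTop (𝓝 (Complex.sin (Real.pi * z))) :=
    Complex.tendsto_euler_sin_prod z
  have h2 : Tendsto (fun n => S (2 * z) (2 * n)) atTop
      (𝓝 (Complex.sin (Real.pi * (2 * z)))) :=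
    (Complex.tendsto_euler_sin_prod (2 * z)).comp
      (tendsto_id.const_mul_atTop' (by norm_num : 0 < 2))
  -- In the sine product at `2z`, even denominators reproduce the sine product at `z` and odd ones
  -- give the cosine product; then `cos = sin 2πz / (2 sin πz)`.
  have hsplit : ∀ n : ℕ, S (2 * z) (2 * n) =
      2 * (∏ k ∈ Finset.range n, (1 - 4 * z ^ 2 / (2 * (k : ℂ) + 1) ^ 2)) * S z n := by
    intro n
    simp only [hS]
    induction n with
    | zero => simp; ring
    | succ n ih =>
      rw [show 2 * (n + 1) = 2 * n + 1 + 1 by ring, Finset.prod_range_succ, Finset.prod_range_succ,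
        Finset.prod_range_succ, Finset.prod_range_succ]
      have e : (2 * z) ^ 2 / (((2 * n + 1 : ℕ) : ℂ) + 1) ^ 2 = z ^ 2 / ((n : ℂ) + 1) ^ 2 := by
        push_cast
        rw [show (2 * (n : ℂ) + 1 + 1) = 2 * (n + 1) by ring, mul_pow, mul_pow,
          mul_div_mul_left _ _ (by norm_num)]
      have e' : (2 * z) ^ 2 / (((2 * n : ℕ) : ℂ) + 1) ^ 2 = 4 * z ^ 2 / (2 * (n : ℂ) + 1) ^ 2 := by
        push_cast
        ring
      rw [e, e', ← mul_assoc, ← mul_assoc, ih]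
      ring
  have h3 := (h2.div h1 hz).div_const 2
  have hlim : Complex.sin (Real.pi * (2 * z)) / Complex.sin (Real.pi * z) / 2 =
      Complex.cos (Real.pi * z) := by
    rw [show (Real.pi : ℂ) * (2 * z) = 2 * (Real.pi * z) by ring, Complex.sin_two_mul]
    field_simp
  rw [hlim] at h3
  refine h3.congr' ?_
  filter_upwards [h1.eventually_ne hz] with n hn
  simp only [Pi.div_apply, hsplit]
  field_simp

/-! ### Contractive Schur multipliers -/

/-- Entrywise multiplication by the matrix `f (xᵢ - yⱼ)` does not increase `N`. -/
def IsSchurContraction {n : ℕ} (N : Seminorm ℂ (Matrix (Fin n) (Fin n) ℂ)) (x y : Fin n → ℝ)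
    (f : ℝ → ℂ) : Prop :=
  ∀ Y : Matrix (Fin n) (Fin n) ℂ, N (Matrix.of fun i j => f (x i - y j) * Y i j) ≤ N Y

namespace IsSchurContraction

variable {n : ℕ} {N : Seminorm ℂ (Matrix (Fin n) (Fin n) ℂ)} {x y : Fin n → ℝ} {f g : ℝ → ℂ}

theorem one : IsSchurContraction N x y fun _ => 1 := fun Y => by
  simp only [one_mul]; exact le_rfl

theorem mul (hf : IsSchurContraction N x y f) (hg : IsSchurContraction N x y g) :
    IsSchurContraction N x y fun t => f t * g t := fun Y => by
  refine le_trans (le_of_eq ?_) ((hf _).trans (hg Y))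
  congr 1
  ext i j
  simp [mul_assoc]

theorem prod {ι : Type*} {s : Finset ι} {F : ι → ℝ → ℂ}
    (hF : ∀ k ∈ s, IsSchurContraction N x y (F k)) :
    IsSchurContraction N x y fun t => ∏ k ∈ s, F k t := by
  classical
  induction s using Finset.induction_on with
  | empty => simpa using one
  | insert a s ha ih =>
    simp only [Finset.prod_insert ha]
    exact (hF a (by simp)).mul (ih fun k hk => hF k (by simp [hk]))

theorem convex_comb (hf : IsSchurContraction N x y f) (hg : IsSchurContraction N x y g)
    {a b : ℝ} (ha : 0 ≤ a) (hb : 0 ≤ b) (hab : a + b = 1) :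
    IsSchurContraction N x y fun t => a * f t + b * g t := fun Y => by
  have e : (Matrix.of fun i j => ((a : ℂ) * f (x i - y j) + b * g (x i - y j)) * Y i j) =
      (a : ℂ) • (Matrix.of fun i j => f (x i - y j) * Y i j) +
        (b : ℂ) • (Matrix.of fun i j => g (x i - y j) * Y i j) := by
    ext i j
    simp
    ring
  rw [e]
  refine (map_add_le_add N _ _).trans ?_
  rw [map_smul_eq_mul, map_smul_eq_mul, Complex.norm_of_nonneg ha, Complex.norm_of_nonneg hb]
  calc _ ≤ a * N Y + b * N Y := by gcongr; exacts [hf Y, hg Y]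
    _ = N Y := by rw [← add_mul, hab, one_mul]

-- Expanding the error in matrix units bounds its seminorm by finitely many terms that tend to zero,
-- so continuity of `N` is not needed.
open Filter Topology in
theorem of_tendsto {F : ℕ → ℝ → ℂ} (hF : ∀ m, IsSchurContraction N x y (F m))
    (hlim : ∀ t, Tendsto (fun m => F m t) atTop (𝓝 (f t))) : IsSchurContraction N x y f := by
  intro Y
  have hbound : ∀ m, N (Matrix.of fun i j => f (x i - y j) * Y i j) ≤
      N Y + ∑ i, ∑ j, ‖(f (x i - y j) - F m (x i - y j)) * Y i j‖ *
        N (Matrix.single i j 1) := by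
    intro m
    have e : (Matrix.of fun i j => f (x i - y j) * Y i j) =
        (Matrix.of fun i j => F m (x i - y j) * Y i j) +
          ∑ i, ∑ j, ((f (x i - y j) - F m (x i - y j)) * Y i j) • Matrix.single i j (1 : ℂ) := by
      rw [← sub_eq_iff_eq_add', Matrix.matrix_eq_sum_single (_ - _)]
      refine Finset.sum_congr rfl fun i _ => Finset.sum_congr rfl fun j _ => ?_
      rw [Matrix.smul_single]
      simp [sub_mul]
    rw [e]
    refine (map_add_le_add N _ _).trans (add_le_add (hF m Y) ?_)
    refine (Finset.le_sum_of_subadditive N (map_zero N).le (map_add_le_add N) _ _).trans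
      (Finset.sum_le_sum fun i _ => ?_)
    refine (Finset.le_sum_of_subadditive N (map_zero N).le (map_add_le_add N) _ _).trans
      (Finset.sum_le_sum fun j _ => ?_)
    rw [map_smul_eq_mul]
  refine ge_of_tendsto' (x := atTop) ?_ hbound
  have : N Y = N Y + ∑ i, ∑ j, ‖(f (x i - y j) - f (x i - y j)) * Y i j‖ *
      N (Matrix.single i j 1) := by simp
  nth_rw 2 [this]
  refine tendsto_const_nhds.add (tendsto_finsetSum _ fun i _ => tendsto_finsetSum _ fun j _ => ?_)
  exact ((tendsto_const_nhds.sub (hlim _)).mul_const _).norm.mul_const _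

/-- The exponential of a difference factors, so the multiplier is conjugation by diagonal unitaries,
an isometry. -/
theorem exp (hN : IsUnitarilyInvariantNorm N) (ω : ℝ) :
    IsSchurContraction N x y fun t => Complex.exp (ω * t * Complex.I) := by
  intro Y
  have hu : ∀ z : Fin n → ℝ, Matrix.diagonal (fun i => Complex.exp (z i * Complex.I)) ∈
      Matrix.unitaryGroup (Fin n) ℂ := by
    intro z
    rw [Matrix.mem_unitaryGroup_iff, Matrix.star_eq_conjTranspose, Matrix.diagonal_conjTranspose,
      Matrix.diagonal_mul_diagonal, ← Matrix.diagonal_one]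
    congr 1
    ext i
    simp [Complex.mul_conj, Complex.normSq_eq_norm_sq, Complex.norm_exp_ofReal_mul_I]
  refine le_of_eq ?_
  rw [← hN.map_unitary_mul_mul _ (hu fun i => ω * x i) _ (hu fun i => -(ω * y i)) Y]
  congr 1
  ext i j
  rw [Matrix.mul_diagonal, Matrix.diagonal_mul, Matrix.of_apply, mul_right_comm, ← Complex.exp_add]
  push_cast
  ring_nf

/-- A resolvent estimate: the image `Z` of `Y` solves `(h + s) Z = h Y + s (e ∘ Z)` with `e`
isometric, and the triangle inequality cancels `s N Z`. -/
theorem inv_of_exp (hN : IsUnitarilyInvariantNorm N) (ω : ℝ) {h s : ℝ} (hh : 0 < h)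
    (hs : 0 ≤ s) : IsSchurContraction N x y fun t =>
      h / (h + s * (1 - Complex.exp (ω * t * Complex.I))) := by
  intro Y
  set e : ℝ → ℂ := fun t => Complex.exp (ω * t * Complex.I) with he
  have hne : ∀ t, (h : ℂ) + s * (1 - e t) ≠ 0 := by
    intro t h0
    have h1 := congrArg Complex.re h0
    have h2 : (e t).re ≤ 1 := by
      refine (Complex.re_le_norm _).trans (le_of_eq ?_)
      simp only [he]
      rw [← Complex.ofReal_mul, Complex.norm_exp_ofReal_mul_I]
    simp at h1
    nlinarith
  set Z : Matrix (Fin n) (Fin n) ℂ :=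
    Matrix.of fun i j => h / (h + s * (1 - e (x i - y j))) * Y i j with hZ
  have key : ((h + s : ℝ) : ℂ) • Z =
      (h : ℂ) • Y + (s : ℂ) • Matrix.of fun i j => e (x i - y j) * Z i j := by
    ext i j
    have := hne (x i - y j)
    simp [hZ]
    field_simp
    ring
  have h3 := congrArg N key
  rw [map_smul_eq_mul, Complex.norm_of_nonneg (by positivity)] at h3
  have h4 := map_add_le_add N ((h : ℂ) • Y) ((s : ℂ) • Matrix.of fun i j => e (x i - y j) * Z i j)
  rw [map_smul_eq_mul, map_smul_eq_mul, Complex.norm_of_nonneg hh.le, Complex.norm_of_nonneg hs]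
    at h4
  have h5 := mul_le_mul_of_nonneg_left (exp (x := x) (y := y) hN ω Z) hs
  have : h * N Z ≤ h * N Y := by linarith
  exact le_of_mul_le_mul_left this hh

open Filter Topology in
theorem inv_one_add_mul_I (hN : IsUnitarilyInvariantNorm N) (s : ℝ) :
    IsSchurContraction N x y fun t => 1 / (1 + s * t * Complex.I) := by
  -- With `h = 1 / (m + 1)`, the quotient `(1 - exp (-i s h t)) / h` tends to `i s t`.
  refine of_tendsto (F := fun m t => ((1 / ((m : ℝ) + 1) : ℝ) : ℂ) / (((1 / ((m : ℝ) + 1) : ℝ) : ℂ)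
    + (1 : ℝ) * (1 - Complex.exp ((-(s / ((m : ℝ) + 1)) : ℝ) * t * Complex.I))))
    (fun m => inv_of_exp hN _ (by positivity) zero_le_one) fun t => ?_
  have hd : HasDerivAt (fun h : ℝ => Complex.exp (-(s * h * t * Complex.I)))
      (-(s * t * Complex.I)) 0 := by
    have h0 : HasDerivAt (fun h : ℝ => -((s : ℂ) * h * t * Complex.I)) (-(s * t * Complex.I)) 0 := by
      have := ((((Complex.ofRealCLM.hasDerivAt (x := (0 : ℝ))).const_mul (s : ℂ)).mul_const
        (t : ℂ)).mul_const Complex.I).neg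
      simp only [Complex.ofRealCLM_apply, Complex.ofReal_one, mul_one] at this
      exact this
    simpa using h0.cexp
  have hseq : Tendsto (fun m : ℕ => 1 / ((m : ℝ) + 1)) atTop (𝓝[≠] 0) :=
    tendsto_nhdsWithin_iff.2 ⟨tendsto_one_div_add_atTop_nhds_zero_nat,
      Eventually.of_forall fun m => by simp; positivity⟩
  have h1 := hd.tendsto_slope_zero.comp hseq
  have hne : (1 : ℂ) - -(s * t * Complex.I) ≠ 0 := by
    intro h0
    have := congrArg Complex.re h0
    simp at this
  have h2 := (tendsto_const_nhds (x := (1 : ℂ))).div (h1.const_sub 1) hne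
  rw [sub_neg_eq_add] at h2
  refine h2.congr fun m => ?_
  have hm : ((m : ℂ) + 1) ≠ 0 := by exact_mod_cast Nat.succ_ne_zero m
  simp only [Pi.div_apply, Function.comp_apply]
  have e : -((s : ℂ) * ((1 / ((m : ℝ) + 1) : ℝ) : ℂ) * t * Complex.I) =
    ((-(s / ((m : ℝ) + 1)) : ℝ) : ℂ) * t * Complex.I := by push_cast; ring
  simp only [zero_add, e]
  rw [Complex.real_smul]
  generalize Complex.exp (((-(s / ((m : ℝ) + 1)) : ℝ) : ℂ) * t * Complex.I) = E
  simp
  rw [← one_div, ← mul_div_mul_left 1 _ (inv_ne_zero hm)]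
  congr 1
  · simp
  · field_simp
    ring

theorem inv_one_add_sq (hN : IsUnitarilyInvariantNorm N) {q : ℝ} (hq : 0 ≤ q) :
    IsSchurContraction N x y fun t => 1 / (1 + q * t ^ 2) := by
  convert (inv_one_add_mul_I hN (√q)).mul (inv_one_add_mul_I hN (-√q)) using 2 with t
  rw [div_mul_div_comm, one_mul]
  congr 1
  have h1 : ((√q : ℝ) : ℂ) ^ 2 = q := by rw [← Complex.ofReal_pow, Real.sq_sqrt hq]
  push_cast
  linear_combination (-(t : ℂ) ^ 2) * h1 + ((√q : ℝ) : ℂ) ^ 2 * t ^ 2 * Complex.I_sq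

/-- For `q > 0` this is the convex combination `p/q + (1 - p/q) / (1 + q t²)`. -/
theorem one_add_sq_div (hN : IsUnitarilyInvariantNorm N) {p q : ℝ} (hp : 0 ≤ p) (hpq : p ≤ q) :
    IsSchurContraction N x y fun t => (1 + p * t ^ 2) / (1 + q * t ^ 2) := by
  rcases hp.trans hpq |>.eq_or_lt with rfl | hq
  · obtain rfl := le_antisymm hpq hp
    simpa using one
  convert one.convex_comb (inv_one_add_sq hN hq.le) (a := p / q) (b := 1 - p / q) (by positivity)
    (sub_nonneg.2 ((div_le_one hq).2 hpq)) (by ring) using 2 with t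
  have h1 : (1 : ℂ) + q * t ^ 2 ≠ 0 := by
    have : 0 < 1 + q * t ^ 2 := by positivity
    exact_mod_cast this.ne'
  have h2 : (q : ℂ) ≠ 0 := by exact_mod_cast hq.ne'
  push_cast
  rw [div_eq_iff h1, add_mul, mul_assoc _ (1 / _), one_div_mul_cancel h1]
  field_simp
  ring

end IsSchurContraction

/-! ### Infinite products for hyperbolic functions -/

open Filter Topology in
theorem tendsto_prod_cosh_mul (β t : ℝ) :
    Tendsto (fun n : ℕ => ∏ k ∈ Finset.range n,
      (1 + (2 * β / ((2 * k + 1) * Real.pi)) ^ 2 * t ^ 2)) atTop (𝓝 (Real.cosh (β * t))) := by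
  have hpi : (Real.pi : ℂ) ≠ 0 := by exact_mod_cast Real.pi_ne_zero
  have hz : (Real.pi : ℂ) * (β * t * Complex.I / Real.pi) = ((β * t : ℝ) : ℂ) * Complex.I := by
    push_cast
    field_simp
  have h := tendsto_euler_cos_prod (z := β * t * Complex.I / Real.pi) (by
    rw [hz, Complex.sin_mul_I, ← Complex.ofReal_sinh]
    by_cases h : β * t = 0
    · left
      rw [← Complex.ofReal_mul, h]
      simp
    · right
      refine mul_ne_zero ?_ Complex.I_ne_zero
      rw [Complex.ofReal_ne_zero]
      exact fun h0 => h (Real.sinh_eq_zero.1 h0))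
  rw [hz, Complex.cos_mul_I, ← Complex.ofReal_cosh] at h
  have h' := (Complex.continuous_re.tendsto _).comp h
  rw [Complex.ofReal_re] at h'
  refine h'.congr fun n => ?_
  rw [Function.comp_apply, ← Complex.ofReal_re (∏ k ∈ Finset.range n, _)]
  congr 1
  push_cast
  refine Finset.prod_congr rfl fun k _ => ?_
  have hk : (2 * (k : ℂ) + 1) ≠ 0 := by exact_mod_cast (2 * k).succ_ne_zero
  field_simp
  rw [Complex.I_sq]
  ring

-- The numerator is `2 cos ((θ + it)/2) cos ((θ - it)/2)`; normalising by its value at `t = 0` gives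
-- the product.
open Filter Topology in
theorem tendsto_prod_cosh_add_cos {θ : ℝ} (hθ : 0 ≤ θ) (hθ' : θ ≤ Real.pi / 2) (t : ℝ) :
    Tendsto (fun n : ℕ => ∏ k ∈ Finset.range n,
      ((1 + (1 / ((2 * k + 1) * Real.pi - θ)) ^ 2 * t ^ 2) *
        (1 + (1 / ((2 * k + 1) * Real.pi + θ)) ^ 2 * t ^ 2))) atTop
      (𝓝 ((Real.cosh t + Real.cos θ) / (1 + Real.cos θ))) := by
  have hpi0 := Real.pi_pos
  have hpi : (Real.pi : ℂ) ≠ 0 := by exact_mod_cast Real.pi_ne_zero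
  have key : ∀ s : ℝ, Tendsto (fun n : ℕ => ∏ k ∈ Finset.range n,
      (1 - 4 * ((θ + s * Complex.I) / (2 * Real.pi)) ^ 2 / (2 * (k : ℂ) + 1) ^ 2)) atTop
      (𝓝 (Complex.cos ((θ + s * Complex.I) / 2))) := by
    intro s
    have hz : (Real.pi : ℂ) * ((θ + s * Complex.I) / (2 * Real.pi)) = (θ + s * Complex.I) / 2 := by
      field_simp
    have h := tendsto_euler_cos_prod (z := (θ + s * Complex.I) / (2 * Real.pi)) (by
      rw [hz, or_iff_not_imp_right, not_not, Complex.sin_eq_zero_iff]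
      rintro ⟨k, hk⟩
      have hre := congrArg Complex.re hk
      have him := congrArg Complex.im hk
      simp at hre him
      have hk0 : k = 0 := by
        have h1 : (-1 : ℝ) < k := by nlinarith
        have h2 : (k : ℝ) < 1 := by nlinarith
        have h1' : -1 < k := by exact_mod_cast h1
        have h2' : k < 1 := by exact_mod_cast h2
        omega
      subst hk0
      have : θ = 0 := by simpa using hre
      simp [this, him])
    rwa [hz] at h
  have hcos : (0 : ℝ) < Real.cos (θ / 2) := Real.cos_pos_of_mem_Ioo ⟨by linarith, by linarith⟩
  have hcos' : Complex.cos ((θ + (0 : ℝ) * Complex.I) / 2) ≠ 0 := by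
    simp only [Complex.ofReal_zero, zero_mul, add_zero]
    exact_mod_cast hcos.ne'
  have h := ((key t).mul (key (-t))).div ((key 0).mul (key 0)) (mul_ne_zero hcos' hcos')
  have hlim : Complex.cos ((θ + t * Complex.I) / 2) * Complex.cos ((θ + (-t : ℝ) * Complex.I) / 2) /
      (Complex.cos ((θ + (0 : ℝ) * Complex.I) / 2) * Complex.cos ((θ + (0 : ℝ) * Complex.I) / 2)) =
      ((Real.cosh t + Real.cos θ) / (1 + Real.cos θ) : ℝ) := by
    have e : ∀ s : ℝ, Complex.cos ((θ + s * Complex.I) / 2) *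
        Complex.cos ((θ + (-s : ℝ) * Complex.I) / 2) = ((Real.cosh s + Real.cos θ) / 2 : ℝ) := by
      intro s
      have := Complex.cos_add_cos θ (s * Complex.I)
      rw [Complex.cos_mul_I] at this
      push_cast
      rw [neg_mul, ← sub_eq_add_neg]
      linear_combination -this / 2
    have e0 := e 0
    rw [neg_zero] at e0
    rw [e, e0, ← Complex.ofReal_div, Real.cosh_zero]
    congr 1
    field_simp
  rw [hlim] at h
  have h' := (Complex.continuous_re.tendsto _).comp h
  rw [Complex.ofReal_re] at h'
  refine h'.congr fun n => ?_
  rw [Function.comp_apply, ← Complex.ofReal_re (∏ k ∈ Finset.range n, _)]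
  congr 1
  push_cast
  simp only [Pi.div_apply, ← Finset.prod_mul_distrib, ← Finset.prod_div_distrib]
  refine Finset.prod_congr rfl fun k _ => ?_
  have hk : (2 * (k : ℂ) + 1) ≠ 0 := by exact_mod_cast (2 * k).succ_ne_zero
  have hP : (Real.pi : ℝ) ≤ (2 * k + 1) * Real.pi := by
    have : (0 : ℝ) ≤ k := k.cast_nonneg
    nlinarith
  have h1 : ((2 * (k : ℂ) + 1) * Real.pi - θ) ≠ 0 := by
    have : (0 : ℝ) < (2 * k + 1) * Real.pi - θ := by linarith
    exact_mod_cast this.ne'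
  have h2 : ((2 * (k : ℂ) + 1) * Real.pi + θ) ≠ 0 := by
    have : (0 : ℝ) < (2 * k + 1) * Real.pi + θ := by linarith
    exact_mod_cast this.ne'
  set P : ℂ := (2 * (k : ℂ) + 1) * Real.pi with hPdef
  have hP0 : P ≠ 0 := mul_ne_zero hk hpi
  have hfac : ∀ w : ℂ, (1 : ℂ) - 4 * (w / (2 * Real.pi)) ^ 2 / (2 * (k : ℂ) + 1) ^ 2 =
      (P - w) * (P + w) / P ^ 2 := by
    intro w
    rw [hPdef]
    field_simp
    ring
  simp only [hfac, zero_mul, add_zero]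
  field_simp
  linear_combination (t : ℂ) ^ 2 * (-2 * P ^ 2 - 2 * θ ^ 2 + t ^ 2 * (Complex.I ^ 2 - 1)) *
    Complex.I_sq

/-! ### The Heinz multiplier -/

namespace IsSchurContraction

variable {n : ℕ} {N : Seminorm ℂ (Matrix (Fin n) (Fin n) ℂ)} {x y : Fin n → ℝ}

open Filter Topology in
theorem cosh_div_cosh_add_cos (hN : IsUnitarilyInvariantNorm N) {θ β : ℝ} (hθ : 0 ≤ θ)
    (hθ' : θ ≤ Real.pi / 2) (hβ : 0 ≤ β) (hβ' : β ≤ 1) (h : (Real.pi - θ) * β ≤ Real.pi / 2) :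
    IsSchurContraction N x y fun t =>
      ((Real.cosh (β * t) / ((Real.cosh t + Real.cos θ) / (1 + Real.cos θ)) : ℝ) : ℂ) := by
  have hpi := Real.pi_pos
  have hcos : 0 ≤ Real.cos θ := Real.cos_nonneg_of_mem_Icc ⟨by linarith, hθ'⟩
  -- Factors `2k` and `2k + 1` of `cosh (β t)` are matched with the zeros at `(2k + 1)π - θ` and
  -- `(2k + 1)π + θ`. The first match at `k = 0` is exactly `h`.
  refine of_tendsto (F := fun m t => ∏ k ∈ Finset.range m,
    (((1 + (((2 * β / ((2 * (2 * k : ℕ) + 1) * Real.pi)) ^ 2 : ℝ) : ℂ) * t ^ 2) /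
      (1 + (((1 / ((2 * k + 1) * Real.pi - θ)) ^ 2 : ℝ) : ℂ) * t ^ 2)) *
    ((1 + (((2 * β / ((2 * (2 * k + 1 : ℕ) + 1) * Real.pi)) ^ 2 : ℝ) : ℂ) * t ^ 2) /
      (1 + (((1 / ((2 * k + 1) * Real.pi + θ)) ^ 2 : ℝ) : ℂ) * t ^ 2))))
    (fun m => prod fun k _ => ?_) fun t => ?_
  · have hk : (0 : ℝ) ≤ k := k.cast_nonneg
    have hkpi : 0 ≤ k * Real.pi := by positivity
    have hkb : k * Real.pi * β ≤ k * Real.pi := mul_le_of_le_one_right hkpi hβ'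
    have hpb : Real.pi * β ≤ Real.pi := mul_le_of_le_one_right hpi.le hβ'
    have hd : 0 < (2 * k + 1) * Real.pi - θ := by nlinarith
    refine mul (one_add_sq_div hN (sq_nonneg _) ?_) (one_add_sq_div hN (sq_nonneg _) ?_)
    · refine pow_le_pow_left₀ (by positivity) ?_ 2
      rw [div_le_div_iff₀ (by positivity) hd]
      push_cast
      linarith
    · refine pow_le_pow_left₀ (by positivity) ?_ 2
      rw [div_le_div_iff₀ (by positivity) (by positivity)]
      push_cast
      have : θ * β ≤ Real.pi / 2 := (mul_le_of_le_one_right hθ hβ').trans hθ'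
      nlinarith
  · have h1 := (tendsto_prod_cosh_mul β t).comp
      (tendsto_id.const_mul_atTop' (by norm_num : 0 < 2))
    have hne : (Real.cosh t + Real.cos θ) / (1 + Real.cos θ) ≠ 0 := by
      have := Real.cosh_pos t
      positivity
    have h2 := h1.div (tendsto_prod_cosh_add_cos hθ hθ' t) hne
    refine ((Complex.continuous_ofReal.tendsto _).comp h2).congr fun m => ?_
    have hpair : ∀ G : ℕ → ℝ, ∏ k ∈ Finset.range (2 * m), G k =
        ∏ k ∈ Finset.range m, G (2 * k) * G (2 * k + 1) := by
      intro G
      induction m with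
      | zero => simp
      | succ m ih =>
        rw [show 2 * (m + 1) = 2 * m + 1 + 1 by ring, Finset.prod_range_succ,
          Finset.prod_range_succ, Finset.prod_range_succ, ih, mul_assoc]
    simp only [Function.comp_apply, Pi.div_apply, id, hpair, ← Finset.prod_div_distrib,
      mul_div_mul_comm]
    push_cast
    rfl

end IsSchurContraction

/-! ### Choice of the angle and the scalar identity -/

theorem exists_cos_eq_of_rOne {ν : ℝ} (hν : ν ∈ Set.Icc (0 : ℝ) 1) :
    ∃ θ, 0 ≤ θ ∧ θ ≤ Real.pi / 2 ∧ (1 - 2 * rOne ν) * Real.cos θ = 2 * rOne ν ∧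
      (Real.pi - θ) * |1 - 2 * ν| ≤ Real.pi / 2 := by
  obtain ⟨h0, h1⟩ := hν
  have hpi := Real.pi_pos
  set β := |1 - 2 * ν| with hβ
  have hβ0 : 0 ≤ β := abs_nonneg _
  have hr : rOne ν = min (β / 2) ((1 - β) / 2) := by
    have e : |1 / 2 - ν| = β / 2 := by
      rw [hβ, ← abs_of_pos (two_pos (α := ℝ)), ← abs_div, abs_of_pos (two_pos (α := ℝ))]
      congr 1
      ring
    rw [rOne, e]
    rcases abs_cases (1 - 2 * ν) with ⟨h, _⟩ | ⟨h, _⟩ <;> rw [← hβ] at h <;> grind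
  have hβ1 : β ≤ 1 := abs_le.2 ⟨by linarith, by linarith⟩
  set r := rOne ν
  have hr1 : r ≤ β / 2 := hr ▸ min_le_left _ _
  have hr2 : r ≤ (1 - β) / 2 := hr ▸ min_le_right _ _
  have hr0 : 0 ≤ r := hr ▸ le_min (by linarith) (by linarith)
  have hd : 0 < 1 - 2 * r := by linarith
  have hc0 : 0 ≤ 2 * r / (1 - 2 * r) := by positivity
  have hc1 : 2 * r / (1 - 2 * r) ≤ 1 := by rw [div_le_one hd]; linarith
  refine ⟨Real.arccos (2 * r / (1 - 2 * r)), Real.arccos_nonneg _,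
    Real.arccos_le_pi_div_two.2 hc0, ?_, ?_⟩
  · rw [Real.cos_arccos (by linarith) hc1]
    field_simp
  -- For `β ≤ 1/2`, `π - θ ≤ π` is enough. Otherwise `θ` must reach the critical angle `φ` with `(π
  -- - φ) β = π / 2`.
  · rcases le_total β (1 / 2) with hb | hb
    · have := Real.arccos_nonneg (2 * r / (1 - 2 * r))
      nlinarith
    · have hbpos : 0 < β := by linarith
      set φ := Real.pi - Real.pi / (2 * β) with hφ
      have hφβ : (Real.pi - φ) * β = Real.pi / 2 := by
        rw [hφ]
        field_simp
        ring
      have hφ0 : 0 ≤ φ := by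
        rw [hφ, sub_nonneg, div_le_iff₀ (by positivity)]
        nlinarith
      have hφ1 : φ ≤ Real.pi / 2 := by
        by_contra! hlt
        nlinarith
      -- Cosine lies above its chord on `[0, π/2]`, whose value at `φ` is `(1 - β) / β`; the bound
      -- `r ≤ (1 - β) / 2` does the rest.
      have hle : 2 * r / (1 - 2 * r) ≤ Real.cos φ := by
        refine le_trans ?_ (Real.one_sub_mul_le_cos hφ0 hφ1)
        have e : 1 - 2 / Real.pi * φ = (1 - β) / β := by
          rw [hφ]
          field_simp
          ring
        rw [e, div_le_div_iff₀ hd hbpos]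
        nlinarith
      have := Real.arccos_le_arccos hle
      rw [Real.arccos_cos hφ0 (by linarith)] at this
      nlinarith

theorem rpow_eq_conj_diagonal {n : ℕ} {A : Matrix (Fin n) (Fin n) ℂ} (hA : A.PosDef) (s : ℝ) :
    A ^ s = (hA.1.eigenvectorUnitary : Matrix (Fin n) (Fin n) ℂ) *
      Matrix.diagonal (fun i => ((hA.1.eigenvalues i ^ s : ℝ) : ℂ)) *
      star (hA.1.eigenvectorUnitary : Matrix (Fin n) (Fin n) ℂ) := by
  rw [CFC.rpow_eq_cfc_real hA.posSemidef.nonneg, hA.1.cfc_eq, Matrix.IsHermitian.cfc,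
    Unitary.conjStarAlgAut_apply]
  rfl

theorem rpow_eq_exp_log_half {a : ℝ} (ha : 0 < a) (s : ℝ) :
    a ^ s = Real.exp (2 * s * (Real.log a / 2)) := by
  rw [Real.rpow_def_of_pos ha]
  congr 1
  ring

theorem heinz_scalar_identity {a b r c ν : ℝ} (ha : 0 < a) (hb : 0 < b) (hc : 0 ≤ c)
    (hr : (1 - 2 * r) * c = 2 * r) :
    Real.cosh (|1 - 2 * ν| * (Real.log a / 2 - Real.log b / 2)) /
        ((Real.cosh (Real.log a / 2 - Real.log b / 2) + c) / (1 + c)) *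
      (4 * r * (a ^ (1 / 2 : ℝ) * b ^ (1 / 2 : ℝ)) +
        (1 - 2 * r) * (a ^ (1 : ℝ) + b ^ (1 : ℝ))) =
      a ^ ν * b ^ (1 - ν) + a ^ (1 - ν) * b ^ ν := by
  simp only [rpow_eq_exp_log_half ha, rpow_eq_exp_log_half hb]
  generalize Real.log a / 2 = x
  generalize Real.log b / 2 = y
  have habs : Real.cosh (|1 - 2 * ν| * (x - y)) = Real.cosh ((1 - 2 * ν) * (x - y)) := by
    rw [← Real.cosh_abs, abs_mul, abs_abs, ← abs_mul, Real.cosh_abs]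
  have hsum : ∀ p q u v : ℝ, p + q = u → p - q = v →
      Real.exp (2 * p) + Real.exp (2 * q) = 2 * (Real.exp u * Real.cosh v) := by
    rintro p q u v rfl rfl
    rw [Real.cosh_eq, ← mul_div_assoc, mul_div_cancel₀ _ two_ne_zero, mul_add, ← Real.exp_add,
      ← Real.exp_add]
    ring_nf
  have e1 : Real.exp (2 * (1 / 2) * x) * Real.exp (2 * (1 / 2) * y) = Real.exp (x + y) := by
    rw [← Real.exp_add]
    ring_nf
  have e2 : Real.exp (2 * 1 * x) + Real.exp (2 * 1 * y) =
      2 * (Real.exp (x + y) * Real.cosh (x - y)) := by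
    rw [mul_one]
    exact hsum x y _ _ rfl rfl
  have e3 : Real.exp (2 * ν * x) * Real.exp (2 * (1 - ν) * y) +
      Real.exp (2 * (1 - ν) * x) * Real.exp (2 * ν * y) =
      2 * (Real.exp (x + y) * Real.cosh ((1 - 2 * ν) * (x - y))) := by
    rw [← hsum ((1 - ν) * x + ν * y) (ν * x + (1 - ν) * y) _ _ (by ring) (by ring),
      ← Real.exp_add, ← Real.exp_add]
    ring_nf
  rw [e1, e2, e3, habs]
  have h1 : Real.cosh (x - y) + c ≠ 0 := by
    have := Real.cosh_pos (x - y)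
    positivity
  have h2 : 1 + c ≠ 0 := by positivity
  -- Hence `2r + (1 - 2r) cosh t = (cosh t + c) / (1 + c)`, which cancels the denominator.
  have h3 : (1 - 2 * r) * (1 + c) = 1 := by linear_combination hr
  field_simp
  linear_combination (2 * Real.cosh (x - y)) * h3 + (-2 * (1 + c)) * hr + 2 * c * h3

/-! ### Reduction to the multiplier -/

theorem mainTheorem2 (n : ℕ) (A B X : Matrix (Fin n) (Fin n) ℂ) (hA : A.PosDef) (hB : B.PosDef)
    (ν : ℝ) (hν : ν ∈ Set.Icc (0 : ℝ) 1)
    (N : Seminorm ℂ (Matrix (Fin n) (Fin n) ℂ)) (hN : IsUnitarilyInvariantNorm N) :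
    N (A ^ ν * X * B ^ (1 - ν) + A ^ (1 - ν) * X * B ^ ν) ≤
      N ((4 * rOne ν) • (A ^ (1 / 2 : ℝ) * X * B ^ (1 / 2 : ℝ)) +
        (1 - 2 * rOne ν) • (A * X + X * B)) := by
  obtain ⟨θ, hθ, hθ', hcr, hβθ⟩ := exists_cos_eq_of_rOne hν
  set r := rOne ν
  have hcos : 0 ≤ Real.cos θ :=
    Real.cos_nonneg_of_mem_Icc ⟨by linarith [Real.pi_pos], hθ'⟩
  set U := (hA.1.eigenvectorUnitary : Matrix (Fin n) (Fin n) ℂ)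
  set V := (hB.1.eigenvectorUnitary : Matrix (Fin n) (Fin n) ℂ)
  set a := hA.1.eigenvalues
  set b := hB.1.eigenvalues
  have hUm : U ∈ Matrix.unitaryGroup (Fin n) ℂ := hA.1.eigenvectorUnitary.2
  have hVm : V ∈ Matrix.unitaryGroup (Fin n) ℂ := hB.1.eigenvectorUnitary.2
  have hpow : ∀ s u : ℝ, A ^ s * X * B ^ u = U * (Matrix.of fun i j =>
      ((a i ^ s * b j ^ u : ℝ) : ℂ) * (star U * X * V) i j) * star V := by
    intro s u
    have e : (Matrix.of fun i j => ((a i ^ s * b j ^ u : ℝ) : ℂ) * (star U * X * V) i j) =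
        Matrix.diagonal (fun i => ((a i ^ s : ℝ) : ℂ)) * (star U * X * V) *
          Matrix.diagonal (fun i => ((b i ^ u : ℝ) : ℂ)) := by
      ext i j
      rw [Matrix.mul_diagonal, Matrix.diagonal_mul, Matrix.of_apply]
      push_cast
      ring
    rw [e, rpow_eq_conj_diagonal hA, rpow_eq_conj_diagonal hB]
    simp only [Matrix.mul_assoc, U, V, a, b]
  -- Zeroth powers put every term in the form handled by `hpow`.
  have hA1 : A * X = A ^ (1 : ℝ) * X * B ^ (0 : ℝ) := by
    rw [CFC.rpow_one A hA.posSemidef.nonneg, CFC.rpow_zero B hB.posSemidef.nonneg, mul_one]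
  have hB1 : X * B = A ^ (0 : ℝ) * X * B ^ (1 : ℝ) := by
    rw [CFC.rpow_one B hB.posSemidef.nonneg, CFC.rpow_zero A hA.posSemidef.nonneg, one_mul]
  rw [hA1, hB1]
  have hsmul : ∀ (c : ℝ) (M : Matrix (Fin n) (Fin n) ℂ),
      c • (U * M * star V) = U * (c • M) * star V := fun c M => by
    rw [Matrix.mul_smul, Matrix.smul_mul]
  simp only [hpow, ← Matrix.mul_add, ← Matrix.add_mul, hsmul]
  rw [hN.map_unitary_mul_mul U hUm _ (Unitary.star_mem hVm),
    hN.map_unitary_mul_mul U hUm _ (Unitary.star_mem hVm)]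
  refine le_trans (le_of_eq ?_) (IsSchurContraction.cosh_div_cosh_add_cos
    (x := fun i => Real.log (a i) / 2) (y := fun j => Real.log (b j) / 2) hN hθ hθ'
    (abs_nonneg _) (abs_le.2 ⟨by linarith [hν.2], by linarith [hν.1]⟩) hβθ _)
  congr 1
  ext i j
  have h := congrArg Complex.ofReal (heinz_scalar_identity (ν := ν) (hA.eigenvalues_pos i)
    (hB.eigenvalues_pos j) hcos hcr)
  simp only [Matrix.of_apply, Matrix.add_apply, Matrix.smul_apply, Complex.real_smul,
    Real.rpow_zero, one_mul, mul_one]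
  rw [← add_mul, ← Complex.ofReal_add, ← h]
  push_cast
  ring
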